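/- Theorem 4.2. Let $G$ be a (real) Banach–Lie group with Lie algebra $L(G)=T_{\mathbf 1}G$, let $M$ be a smooth Banach manifold, let $\sigma\colon G\times M\to M$, $(g,m)\mapsto g.m$, be a smooth action of $G$ on $M$, and let $p\in M$. For $x\in L(G)$ let $\dot\sigma(x)$ be the vector field on $M$ given by $$\dot\sigma(x)(m) := -d\sigma(\mathbf 1,m)(x,0)\in T_m(M).$$ Suppose that the subspace $\dot\sigma(L(G))(p)=\{\dot\sigma(x)(p) : x\in L(G)\}$ of $T_p(M)$ is closed. Then the stabilizer $$G_p := \{g\in G : g.p=p\}$$ is a Banach–Lie subgroup of $G$, i.e. $G_p$ is a closed subgroup of $G$ and, with respect to the subspace topology, it is a Banach–Lie group: it carries, compatibly with the subspace topology, a smooth manifold structure modelled on a Banach space for which multiplication and inversion are smooth. (No closed complement of the Lie algebra of $G_p$ in $L(G)$ is required.) -/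

import Mathlib

open scoped Manifold ContDiff

universe u v w z

noncomputable section

/-- The topological group `K` is a (real) Banach–Lie group: it carries, for its given topology and
its given group structure, the structure of a smooth manifold modelled on some real Banach space
`F` for which multiplication and inversion are smooth. -/
def IsBanachLieGroup (K : Type w) [Group K] [TopologicalSpace K] : Prop :=
  ∃ (F : Type v) (_ : NormedAddCommGroup F) (_ : NormedSpace ℝ F) (_ : CompleteSpace F)
    (_ : ChartedSpace F K), LieGroup 𝓘(ℝ, F) ∞ K

/-- A subgroup `H` of a Banach–Lie group `G` is a Banach–Lie subgroup if it is closed and is a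
Banach–Lie group with respect to the subspace topology. (No complement of the Lie algebra of `H`
is required.) -/
def IsBanachLieSubgroup {G : Type w} [Group G] [TopologicalSpace G]
    (H : Subgroup G) : Prop :=
  IsClosed (H : Set G) ∧ IsBanachLieGroup.{v, w} H

/-- The derived action `σ̇ : L(G) → 𝒱(M)`, `σ̇(x)(m) = -dσ(1, m)(x, 0)`, of an action
`σ : G × M → M`, `σ(g, m) = g • m`. The derivative takes values in the tangent space at
`1 • m`, which is the point `m`. -/
def derivedAction {E : Type*} [NormedAddCommGroup E] [NormedSpace ℝ E]
    {E' : Type*} [NormedAddCommGroup E'] [NormedSpace ℝ E']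
    {G : Type*} [Group G] [TopologicalSpace G] [ChartedSpace E G]
    {M : Type*} [TopologicalSpace M] [ChartedSpace E' M] [MulAction G M]
    (x : GroupLieAlgebra 𝓘(ℝ, E) G) (m : M) : TangentSpace 𝓘(ℝ, E') m :=
  -(mfderiv (𝓘(ℝ, E).prod 𝓘(ℝ, E')) 𝓘(ℝ, E') (fun q : G × M => q.1 • q.2) ((1 : G), m)
    ((x, 0) : E × E'))

end

/-!
The stabilizer is described near the identity by a chart of `G` that turns it into the kernel of the
derivative `T` of the orbit map at the identity. This kernel is closed but need not have a closed
complement, so the implicit function theorem does not apply, and the chart has to come from the group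
structure: logarithmic coordinates. Since only squaring matters for the argument, the exponential map
is replaced by a linearization of the squaring map.

In a chart centred at `1` the squaring map has derivative `2` and hence a local inverse `t` with
derivative `1/2`. The limit `ψ = lim 2 ^ n • t^[n]` (`koenigs`) is smooth with derivative `1` at `0`
and satisfies `ψ x = 2 • ψ (t x)`. Its regularity (`IsHalving.contDiffOn_koenigs`) follows by
induction over all Banach spaces at once: the derivative of `ψ` is part of the linearization of the
halving map `(x, A) ↦ (t x, D t(x) ∘ A)`.

Let `f` be the orbit map `g ↦ g • p` in charts, so that the stabilizer is the zero set of `f`.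

* If `ψ x ∈ ker T`, then `y = t^[n] x` satisfies `T y = O(‖y‖ ^ 2)`, so `f y = O(‖y‖ ^ 2)` decays
  like `(3/5) ^ (2 n)`, whereas going back from `y` to `x` by `n` squarings multiplies the
  displacement of `p` by at most `(5/2) ^ n` (`norm_orbit_sq_le`). Hence `f x = 0`
  (`eventually_eq_zero_of_koenigs_mem_ker`).
* If `f x = 0`, the closed range of `T` and the open mapping theorem allow splitting off from `ψ x` an
  element of `ker T` such that the rest `z` is bounded by `T z`. Division in the group moves the rest
  into the zero set of `f` up to a small relative error, so `T z` is small compared with `z`, and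
  `z = 0` (`eventually_koenigs_mem_ker_of_eq_zero`).

Translates of this slice chart form an atlas of the stabilizer (`isBanachLieGroup_of_slice`). All
smoothness statements reduce to `G` since a map into a closed subspace is smooth as soon as it is
smooth as a map into the ambient space (`LinearIsometry.contDiffAt_of_comp`).
-/

open scoped Manifold ContDiff
open Filter Topology Metric

/-! ### Linearization of maps with derivative one half -/

section Linearization

variable {E : Type*} [NormedAddCommGroup E] [NormedSpace ℝ E]
variable {F : Type*} [NormedAddCommGroup F] [NormedSpace ℝ F]

theorem ContDiffAt.exists_norm_sub_fderiv_le_sq {f : E → F} (hf : ContDiffAt ℝ 2 f 0)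
    (h0 : f 0 = 0) :
    ∃ C ≥ 0, ∃ r > 0, ∀ x, ‖x‖ < r → ‖f x - fderiv ℝ f 0 x‖ ≤ C * ‖x‖ ^ 2 := by
  have h1 : ContDiffAt ℝ 1 (fderiv ℝ f) 0 := hf.fderiv_right (by norm_num)
  obtain ⟨K, s, hs, hK⟩ := h1.exists_lipschitzOnWith
  have hd : ∀ᶠ y in 𝓝 (0 : E), DifferentiableAt ℝ f y :=
    (hf.eventually (by simp)).mono fun y hy => hy.differentiableAt (by simp)
  obtain ⟨r, hr, hball⟩ := Metric.eventually_nhds_iff_ball.1 (hd.and hs)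
  refine ⟨K, K.2, r, hr, fun x hx => ?_⟩
  have key := (convex_closedBall (0 : E) ‖x‖).norm_image_sub_le_of_norm_fderiv_le' (f := f)
    (C := K * ‖x‖) (φ := fderiv ℝ f 0) (x := 0) (y := x) (𝕜 := ℝ) ?_ ?_ (by simp) (by simp)
  · simpa [h0, pow_two, mul_assoc] using key
  · intro y hy
    exact (hball y (by simp at hy ⊢; linarith)).1
  · intro y hy
    have hy' : ‖y‖ ≤ ‖x‖ := by simpa using hy
    have := hK.dist_le_mul y (hball y (by simp; linarith)).2 0 (hball 0 (by simpa using hr)).2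
    rw [dist_eq_norm, dist_zero_right] at this
    exact this.trans (by gcongr)

/-- `t` is smooth near the fixed point `0`, where its derivative is multiplication by `1/2`. -/
structure IsHalving (t : E → E) : Prop where
  smooth : ∀ᶠ x in 𝓝 0, ContDiffAt ℝ ∞ t x
  map_zero : t 0 = 0
  hasFDerivAt : HasFDerivAt t ((1 / 2 : ℝ) • ContinuousLinearMap.id ℝ E) 0

/-- Quantitative form of `IsHalving`. The contraction rate `3/5` is chosen with `2 * (3/5)^2 < 1`,
which makes `2 ^ n • t^[n]` converge. -/
structure HalvingOn (t : E → E) (r C : ℝ) : Prop where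
  pos : 0 < r
  nonneg : 0 ≤ C
  contDiffAt : ∀ x, ‖x‖ < r → ContDiffAt ℝ ∞ t x
  norm_le : ∀ x, ‖x‖ < r → ‖t x‖ ≤ 3 / 5 * ‖x‖
  norm_sub_le : ∀ x, ‖x‖ < r → ‖(2 : ℝ) • t x - x‖ ≤ C * ‖x‖ ^ 2

theorem IsHalving.exists_halvingOn {t : E → E} (h : IsHalving t) :
    ∃ r C, HalvingOn t r C := by
  obtain ⟨C, hC, r, hr, hq⟩ := (h.smooth.self_of_nhds.of_le
    ENat.LEInfty.out).exists_norm_sub_fderiv_le_sq h.map_zero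
  rw [h.hasFDerivAt.fderiv] at hq
  obtain ⟨r', hr', hs⟩ := Metric.eventually_nhds_iff_ball.1 h.smooth
  have hC1 : 0 < 10 * (C + 1) := by positivity
  refine ⟨min (min r r') (1 / (10 * (C + 1))), 2 * C, by positivity, by positivity, ?_, ?_, ?_⟩
  · intro x hx
    simp only [lt_min_iff] at hx
    exact hs x (by simpa using hx.1.2)
  · intro x hx
    simp only [lt_min_iff] at hx
    have h1 := hq x hx.1.1
    have h2 : ‖t x‖ ≤ ‖(1 / 2 : ℝ) • x‖ + C * ‖x‖ ^ 2 := by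
      have := norm_le_norm_add_norm_sub ((1 / 2 : ℝ) • x) (t x)
      rw [norm_sub_rev] at this
      exact this.trans (by simpa using h1)
    rw [norm_smul, Real.norm_of_nonneg (by norm_num)] at h2
    have h3 : ‖x‖ * (10 * (C + 1)) < 1 := (lt_div_iff₀ hC1).1 hx.2
    nlinarith [norm_nonneg x]
  · intro x hx
    simp only [lt_min_iff] at hx
    have h1 := hq x hx.1.1
    have h2 : (2 : ℝ) • t x - x = (2 : ℝ) • (t x - ((1 / 2 : ℝ) • ContinuousLinearMap.id ℝ E) x) := by
      simp [smul_sub, smul_smul]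
    rw [h2, norm_smul, Real.norm_of_nonneg (by norm_num)]
    linarith

/-- The Koenigs linearization of a halving map: the limit of `2 ^ n • t^[n] x`, written as a
telescoping series (so the value is only meaningful where the series converges). -/
noncomputable def koenigs (t : E → E) (x : E) : E :=
  x + ∑' n : ℕ, ((2 : ℝ) ^ (n + 1) • t^[n + 1] x - (2 : ℝ) ^ n • t^[n] x)

namespace HalvingOn

variable {t : E → E} {r C : ℝ}

theorem mono (H : HalvingOn t r C) {r' : ℝ} (h0 : 0 < r') (h : r' ≤ r) : HalvingOn t r' C :=
  ⟨h0, H.nonneg, fun x hx => H.contDiffAt x (hx.trans_le h), fun x hx => H.norm_le x (hx.trans_le h),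
    fun x hx => H.norm_sub_le x (hx.trans_le h)⟩

theorem norm_iterate_le (H : HalvingOn t r C) {x : E} (hx : ‖x‖ < r) (n : ℕ) :
    ‖t^[n] x‖ ≤ (3 / 5) ^ n * ‖x‖ := by
  induction n with
  | zero => simp
  | succ n ih =>
    have h1 : (3 / 5 : ℝ) ^ n ≤ 1 := pow_le_one₀ (by norm_num) (by norm_num)
    have h2 : ‖t^[n] x‖ < r := by nlinarith [norm_nonneg x]
    rw [Function.iterate_succ_apply', pow_succ]
    have := H.norm_le _ h2
    linarith

theorem norm_iterate_lt (H : HalvingOn t r C) {x : E} (hx : ‖x‖ < r) (n : ℕ) : ‖t^[n] x‖ < r := by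
  have h1 : (3 / 5 : ℝ) ^ n ≤ 1 := pow_le_one₀ (by norm_num) (by norm_num)
  have h2 := H.norm_iterate_le hx n
  nlinarith [norm_nonneg x]

theorem contDiffAt_iterate (H : HalvingOn t r C) {x : E} (hx : ‖x‖ < r) (n : ℕ) :
    ContDiffAt ℝ ∞ t^[n] x := by
  induction n with
  | zero => exact contDiffAt_id
  | succ n ih =>
    rw [Function.iterate_succ']
    exact (H.contDiffAt _ (H.norm_iterate_lt hx n)).comp x ih

theorem norm_term_le (H : HalvingOn t r C) {x : E} (hx : ‖x‖ < r) (n : ℕ) :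
    ‖(2 : ℝ) ^ (n + 1) • t^[n + 1] x - (2 : ℝ) ^ n • t^[n] x‖ ≤ C * ‖x‖ ^ 2 * (18 / 25) ^ n := by
  have h1 : (2 : ℝ) ^ (n + 1) • t^[n + 1] x - (2 : ℝ) ^ n • t^[n] x
      = (2 : ℝ) ^ n • ((2 : ℝ) • t (t^[n] x) - t^[n] x) := by
    rw [Function.iterate_succ_apply', smul_sub, smul_smul, pow_succ]
  have hC := H.nonneg
  rw [h1, norm_smul, Real.norm_of_nonneg (by positivity)]
  calc (2 : ℝ) ^ n * ‖(2 : ℝ) • t (t^[n] x) - t^[n] x‖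
      ≤ 2 ^ n * (C * ((3 / 5) ^ n * ‖x‖) ^ 2) := by
        gcongr
        refine (H.norm_sub_le _ (H.norm_iterate_lt hx n)).trans ?_
        gcongr
        exact H.norm_iterate_le hx n
    _ = C * ‖x‖ ^ 2 * (2 ^ n * ((3 / 5) ^ n) ^ 2) := by ring
    _ = C * ‖x‖ ^ 2 * (18 / 25) ^ n := by
        rw [← pow_mul, mul_comm n 2, pow_mul, ← mul_pow]; norm_num

theorem tendstoUniformlyOn [CompleteSpace E] (H : HalvingOn t r C) :
    TendstoUniformlyOn (fun (n : ℕ) x => (2 : ℝ) ^ n • t^[n] x) (koenigs t) atTop (ball 0 r) := by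
  have hC := H.nonneg
  have hsum : Summable fun n : ℕ => C * r ^ 2 * (18 / 25 : ℝ) ^ n :=
    (summable_geometric_of_lt_one (by norm_num) (by norm_num)).mul_left _
  have key := tendstoUniformlyOn_tsum_nat (F := E) hsum (s := ball (0 : E) r)
    (f := fun n x => (2 : ℝ) ^ (n + 1) • t^[n + 1] x - (2 : ℝ) ^ n • t^[n] x) (by
      intro n x hx
      have hx' : ‖x‖ < r := by simpa using hx
      refine (H.norm_term_le hx' n).trans ?_
      gcongr)
  rw [Metric.tendstoUniformlyOn_iff] at key ⊢
  intro ε hε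
  filter_upwards [key ε hε] with n hn x hx
  have := hn x hx
  rw [Finset.sum_range_sub (fun n => (2 : ℝ) ^ n • t^[n] x)] at this
  simp only [pow_zero, one_smul, Function.iterate_zero, id_eq] at this
  rw [koenigs, dist_eq_norm] at *
  convert! this using 2
  abel

theorem tendsto [CompleteSpace E] (H : HalvingOn t r C) {x : E} (hx : ‖x‖ < r) :
    Tendsto (fun n : ℕ => (2 : ℝ) ^ n • t^[n] x) atTop (𝓝 (koenigs t x)) :=
  H.tendstoUniformlyOn.tendsto_at (by simpa using hx)

theorem norm_koenigs_sub_le (H : HalvingOn t r C) {x : E} (hx : ‖x‖ < r) :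
    ‖koenigs t x - x‖ ≤ 25 / 7 * C * ‖x‖ ^ 2 := by
  rw [koenigs, add_sub_cancel_left]
  refine tsum_of_norm_bounded ?_ (H.norm_term_le hx)
  have := (hasSum_geometric_of_lt_one (r := (18 / 25 : ℝ)) (by norm_num)
    (by norm_num)).mul_left (C * ‖x‖ ^ 2)
  convert! this using 1
  norm_num
  ring

theorem koenigs_zero (H : HalvingOn t r C) : koenigs t 0 = 0 := by
  simpa using H.norm_koenigs_sub_le (x := 0) (by simpa using H.pos)

theorem koenigs_apply [CompleteSpace E] (H : HalvingOn t r C) {x : E} (hx : ‖x‖ < r) :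
    koenigs t x = (2 : ℝ) • koenigs t (t x) := by
  have h1 := (H.tendsto hx).comp (tendsto_add_atTop_nat 1)
  have h2 := (H.tendsto (H.norm_iterate_lt hx 1)).const_smul (2 : ℝ)
  refine tendsto_nhds_unique h1 (h2.congr fun n => ?_)
  simp [pow_succ', smul_smul]

theorem koenigs_iterate [CompleteSpace E] (H : HalvingOn t r C) {x : E} (hx : ‖x‖ < r) (n : ℕ) :
    koenigs t x = (2 : ℝ) ^ n • koenigs t (t^[n] x) := by
  induction n with
  | zero => simp
  | succ n ih =>
    rw [ih, H.koenigs_apply (H.norm_iterate_lt hx n), smul_smul, pow_succ,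
      Function.iterate_succ_apply']

theorem hasFDerivAt_koenigs_zero (H : HalvingOn t r C) :
    HasFDerivAt (koenigs t) (ContinuousLinearMap.id ℝ E) 0 := by
  refine .of_isLittleO ?_
  simp only [H.koenigs_zero, sub_zero, ContinuousLinearMap.id_apply]
  refine (Asymptotics.IsBigO.of_bound (25 / 7 * C) ?_ :
    (fun x => koenigs t x - x) =O[𝓝 0] fun x => ‖x‖ ^ 2).trans_isLittleO ?_
  · filter_upwards [ball_mem_nhds (0 : E) H.pos] with x hx
    simpa using H.norm_koenigs_sub_le (by simpa using hx)
  · simpa using (Asymptotics.isLittleO_norm_pow_id (E' := E) (n := 2) one_lt_two)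

end HalvingOn

/-- The action of `t` on the bundle of endomorphisms of the tangent spaces. Its iterates are
`(x, A) ↦ (t^[n] x, D(t^[n])(x) ∘ A)`, so that its Koenigs linearization contains the derivative of
the one of `t`. -/
noncomputable def halvingProlong (t : E → E) (q : E × (E →L[ℝ] E)) : E × (E →L[ℝ] E) :=
  (t q.1, (fderiv ℝ t q.1).comp q.2)

theorem IsHalving.prolong {t : E → E} (h : IsHalving t) : IsHalving (halvingProlong t) := by
  have hfst : Tendsto (Prod.fst : E × (E →L[ℝ] E) → E) (𝓝 0) (𝓝 0) :=
    (continuous_fst.tendsto' _ _ rfl)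
  refine ⟨?_, by simp [halvingProlong, h.map_zero], ?_⟩
  · filter_upwards [hfst.eventually h.smooth] with q hq
    refine (hq.comp q contDiffAt_fst).prodMk ?_
    exact ((hq.fderiv_right (m := ∞) (by simp)).comp q contDiffAt_fst).clm_comp contDiffAt_snd
  · have h1 : HasFDerivAt (fun q : E × (E →L[ℝ] E) => t q.1)
        (((1 / 2 : ℝ) • ContinuousLinearMap.id ℝ E).comp (ContinuousLinearMap.fst ℝ E (E →L[ℝ] E)))
        0 := HasFDerivAt.comp (0 : E × (E →L[ℝ] E)) h.hasFDerivAt hasFDerivAt_fst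
    have hd : DifferentiableAt ℝ (fderiv ℝ t) 0 :=
      (h.smooth.self_of_nhds.fderiv_right (m := 1)
        (one_add_one_eq_two.trans_le ENat.LEInfty.out)).differentiableAt (by simp)
    have h2 : HasFDerivAt (fun q : E × (E →L[ℝ] E) => fderiv ℝ t q.1)
        ((fderiv ℝ (fderiv ℝ t) 0).comp (ContinuousLinearMap.fst ℝ E (E →L[ℝ] E))) 0 :=
      HasFDerivAt.comp (0 : E × (E →L[ℝ] E)) hd.hasFDerivAt hasFDerivAt_fst
    have h3 := h2.clm_comp (hasFDerivAt_snd (𝕜 := ℝ) (p := (0 : E × (E →L[ℝ] E))))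
    refine (h1.prodMk h3).congr_fderiv ?_
    ext1 <;> ext <;> simp [h.hasFDerivAt.fderiv]

theorem HalvingOn.iterate_prolong {t : E → E} {r C : ℝ} (H : HalvingOn t r C) {x : E} (hx : ‖x‖ < r)
    (A : E →L[ℝ] E) (n : ℕ) :
    (halvingProlong t)^[n] (x, A) = (t^[n] x, (fderiv ℝ t^[n] x).comp A) := by
  induction n with
  | zero =>
    simp only [Function.iterate_zero, id_eq]
    rw [show (id : E → E) = fun x => x from rfl, fderiv_fun_id]
    simp
  | succ n ih =>
    rw [Function.iterate_succ_apply', ih, halvingProlong]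
    simp only
    rw [Function.iterate_succ', fderiv_comp _
      ((H.contDiffAt _ (H.norm_iterate_lt hx n)).differentiableAt (by simp))
      ((H.contDiffAt_iterate hx n).differentiableAt (by simp))]
    rfl

/-- A `C ^ k` regularity of the linearization near `0` extends to the whole domain of contraction by
`koenigs t x = 2 ^ n • koenigs t (t^[n] x)`. -/
theorem HalvingOn.contDiffAt_koenigs_of_zero [CompleteSpace E] {t : E → E} {r C : ℝ}
    (H : HalvingOn t r C) {k : ℕ∞} {ρ : ℝ} (hρ : 0 < ρ)
    (hk : ∀ x, ‖x‖ < ρ → ContDiffAt ℝ k (koenigs t) x) {x : E} (hx : ‖x‖ < r) :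
    ContDiffAt ℝ k (koenigs t) x := by
  have h0 : Tendsto (fun n : ℕ => (3 / 5 : ℝ) ^ n * r) atTop (𝓝 0) := by
    simpa using (tendsto_pow_atTop_nhds_zero_of_lt_one (r := (3 / 5 : ℝ)) (by norm_num)
      (by norm_num)).mul_const r
  obtain ⟨n, hn⟩ := (h0.eventually (gt_mem_nhds hρ)).exists
  have hxn : ‖t^[n] x‖ < ρ := by
    refine (H.norm_iterate_le hx n).trans_lt (lt_of_le_of_lt ?_ hn)
    gcongr
  have h1 : ContDiffAt ℝ k (fun y => (2 : ℝ) ^ n • koenigs t (t^[n] y)) x :=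
    ((hk _ hxn).comp x ((H.contDiffAt_iterate hx n).of_le (by exact_mod_cast le_top))).const_smul _
  refine h1.congr_of_eventuallyEq ?_
  filter_upwards [isOpen_ball.mem_nhds (show x ∈ ball (0 : E) r by simpa using hx)] with y hy
  exact H.koenigs_iterate (by simpa using hy) n

end Linearization

/-- The derivatives of `2 ^ n • t^[n]` are read off from the iterates of `halvingProlong t`, whose
linearization is of class `C ^ k` by induction; this gives class `C ^ (k + 1)` for that of `t`. -/
theorem IsHalving.contDiffOn_koenigs (k : ℕ) :
    ∀ {E : Type u} [NormedAddCommGroup E] [NormedSpace ℝ E] [CompleteSpace E] {t : E → E},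
      IsHalving t → ∃ ρ > 0, ContDiffOn ℝ k (koenigs t) (ball 0 ρ) := by
  induction k with
  | zero =>
    intro E _ _ _ t h
    obtain ⟨r, C, H⟩ := h.exists_halvingOn
    refine ⟨r, H.pos, contDiffOn_zero.2 (H.tendstoUniformlyOn.continuousOn (.of_forall fun n => ?_))⟩
    intro x hx
    exact ((H.contDiffAt_iterate (by simpa using hx) n).continuousAt.const_smul _).continuousWithinAt
  | succ k ih =>
    intro E _ _ _ t h
    obtain ⟨r, C, H⟩ := h.exists_halvingOn
    obtain ⟨r', C', H'⟩ := h.prolong.exists_halvingOn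
    obtain ⟨ρ', hρ', hk⟩ := ih h.prolong
    set ρ := min r (min r' ρ') with hρdef
    have hρ : 0 < ρ := lt_min H.pos (lt_min H'.pos hρ')
    -- The derivative is evaluated at a multiple `A` of the identity that is small enough for `(x, A)`
    -- to lie in the domain of convergence; dividing by the scalar `c` recovers `D t^[n] (x)`.
    set c := ρ / 2 with hc
    have hc0 : 0 < c := half_pos hρ
    set A : E →L[ℝ] E := c • ContinuousLinearMap.id ℝ E with hA
    have hAn : ‖A‖ < ρ := by
      rw [hA, norm_smul, Real.norm_of_nonneg hc0.le]
      have := ContinuousLinearMap.norm_id_le (𝕜 := ℝ) (E := E)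
      nlinarith
    have hmem : ∀ x ∈ ball (0 : E) ρ, (x, A) ∈ ball (0 : E × (E →L[ℝ] E)) ρ := by
      intro x hx
      have hx' : ‖x‖ < ρ := by simpa using hx
      simp only [mem_ball_zero_iff, Prod.norm_def]
      exact max_lt hx' hAn
    set D : E → E →L[ℝ] E := fun x => c⁻¹ • (koenigs (halvingProlong t) (x, A)).2 with hD
    have hDsmooth : ContDiffOn ℝ k D (ball 0 ρ) := by
      refine ContDiffOn.const_smul _ ?_
      refine contDiff_snd.comp_contDiffOn (hk.comp (contDiff_prodMk_left A).contDiffOn ?_)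
      exact fun x hx => ball_subset_ball ((min_le_right _ _).trans (min_le_right _ _)) (hmem x hx)
    have hunif : TendstoUniformlyOn (fun (n : ℕ) x => (2 : ℝ) ^ n • fderiv ℝ t^[n] x) D atTop
        (ball 0 ρ) := by
      have h1 := (H'.tendstoUniformlyOn.mono (ball_subset_ball
        ((min_le_right _ _).trans (min_le_left _ _) : ρ ≤ r'))).comp (fun x : E => (x, A))
      have h2 := ((uniformContinuous_snd (α := E) (β := E →L[ℝ] E)).const_smul
        c⁻¹).comp_tendstoUniformlyOn (h1.mono (s' := ball 0 ρ) hmem)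
      refine h2.congr (.of_forall fun n x hx => ?_)
      have hx' : ‖x‖ < r := lt_of_lt_of_le (mem_ball_zero_iff.1 hx) (min_le_left _ _)
      simp only [Function.comp_apply, H.iterate_prolong hx']
      ext v
      simp [hA, smul_smul]
      congr 1
      field_simp
    have hderiv : ∀ x ∈ ball (0 : E) ρ, HasFDerivAt (koenigs t) (D x) x := by
      intro x hx
      refine hasFDerivAt_of_tendstoUniformlyOn isOpen_ball hunif
        (f := fun (n : ℕ) x => (2 : ℝ) ^ n • t^[n] x) ?_ ?_ hx
      · intro n y hy
        have hy' : ‖y‖ < r := lt_of_lt_of_le (mem_ball_zero_iff.1 hy) (min_le_left _ _)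
        exact (((H.contDiffAt_iterate hy' n).differentiableAt (by simp)).hasFDerivAt).const_smul _
      · intro y hy
        exact H.tendsto (lt_of_lt_of_le (mem_ball_zero_iff.1 hy) (min_le_left _ _))
    refine ⟨ρ, hρ, ?_⟩
    have := (contDiffOn_succ_iff_hasFDerivWithinAt_of_uniqueDiffOn (n := (k : WithTop ℕ∞)) (𝕜 := ℝ)
      (f := koenigs t) (isOpen_ball (x := (0 : E)) (ε := ρ)).uniqueDiffOn).2
      ⟨by simp, D, hDsmooth, fun x hx => (hderiv x hx).hasFDerivWithinAt⟩
    exact_mod_cast this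

theorem HalvingOn.contDiffAt_koenigs {E : Type*} [NormedAddCommGroup E] [NormedSpace ℝ E]
    [CompleteSpace E] {t : E → E} {r C : ℝ} (H : HalvingOn t r C) (h : IsHalving t) {x : E}
    (hx : ‖x‖ < r) : ContDiffAt ℝ ∞ (koenigs t) x := by
  refine contDiffAt_infty.2 fun k => ?_
  obtain ⟨ρ, hρ, hk⟩ := h.contDiffOn_koenigs k
  refine H.contDiffAt_koenigs_of_zero (k := k) hρ (fun y hy => ?_) hx
  exact hk.contDiffAt (isOpen_ball.mem_nhds (by simpa using hy))

/-! ### The zero set in linearizing coordinates -/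

section ZeroSet

variable {E : Type u} [NormedAddCommGroup E] [NormedSpace ℝ E] [CompleteSpace E]
variable {F : Type*} [NormedAddCommGroup F] [NormedSpace ℝ F]

/-- The linearization maps the points sent to `ker T` into the zero set of `f`: at `y = t^[n] x` the
value `f y` is of second order in `y`, hence `O((3/5) ^ (2 n))`, while passing from `y` back to `x`
increases it by a factor of at most `(5/2) ^ n`. -/
theorem eventually_eq_zero_of_koenigs_mem_ker {f : E → F} {T : E →L[ℝ] F} {t : E → E}
    (ht : IsHalving t) (hf : ContDiffAt ℝ 2 f 0) (hf0 : f 0 = 0) (hT : HasFDerivAt f T 0)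
    (hft : ∀ᶠ x in 𝓝 0, ‖f x‖ ≤ 5 / 2 * ‖f (t x)‖) :
    ∀ᶠ x in 𝓝 0, T (koenigs t x) = 0 → f x = 0 := by
  obtain ⟨r, C, H⟩ := ht.exists_halvingOn
  obtain ⟨K, hK, r₁, hr₁, hq⟩ := hf.exists_norm_sub_fderiv_le_sq hf0
  rw [hT.fderiv] at hq
  obtain ⟨r₂, hr₂, hft⟩ := Metric.eventually_nhds_iff_ball.1 hft
  have hρ : 0 < min r (min r₁ r₂) := lt_min H.pos (lt_min hr₁ hr₂)
  have H := H.mono hρ (min_le_left _ _)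
  filter_upwards [ball_mem_nhds (0 : E) hρ] with x hx hTx
  rw [mem_ball_zero_iff] at hx
  have hC := H.nonneg
  have hlt := H.norm_iterate_lt hx
  have hsecond : ∀ n : ℕ,
      ‖f (t^[n] x)‖ ≤ (K + ‖T‖ * (25 / 7 * C)) * ((3 / 5) ^ n * ‖x‖) ^ 2 := by
    intro n
    have hker : T (koenigs t (t^[n] x)) = 0 := by
      rw [H.koenigs_iterate hx n, map_smul, smul_eq_zero] at hTx
      exact hTx.resolve_left (by positivity)
    have h1 := hq _ ((hlt n).trans_le ((min_le_right _ _).trans (min_le_left _ _)))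
    have h2 : ‖T (t^[n] x)‖ ≤ ‖T‖ * (25 / 7 * C * ‖t^[n] x‖ ^ 2) := by
      have : T (t^[n] x) = - T (koenigs t (t^[n] x) - t^[n] x) := by rw [map_sub, hker]; simp
      rw [this, norm_neg]
      refine (T.le_opNorm _).trans ?_
      gcongr
      exact H.norm_koenigs_sub_le (hlt n)
    have h3 := norm_le_norm_add_norm_sub (T (t^[n] x)) (f (t^[n] x))
    rw [norm_sub_rev] at h3
    calc ‖f (t^[n] x)‖ ≤ (K + ‖T‖ * (25 / 7 * C)) * ‖t^[n] x‖ ^ 2 := by linarith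
      _ ≤ _ := by gcongr; exact H.norm_iterate_le hx n
  have hback : ∀ n : ℕ, ‖f x‖ ≤ (5 / 2) ^ n * ‖f (t^[n] x)‖ := by
    intro n
    induction n with
    | zero => simp
    | succ n ih =>
      have := hft (t^[n] x) (mem_ball_zero_iff.2
        ((hlt n).trans_le ((min_le_right _ _).trans (min_le_right _ _))))
      rw [Function.iterate_succ_apply', pow_succ]
      refine ih.trans ?_
      rw [mul_assoc]
      gcongr
  have hbound : ∀ n : ℕ, ‖f x‖ ≤ (K + ‖T‖ * (25 / 7 * C)) * ‖x‖ ^ 2 * (9 / 10) ^ n := by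
    intro n
    calc ‖f x‖ ≤ (5 / 2) ^ n * ((K + ‖T‖ * (25 / 7 * C)) * ((3 / 5) ^ n * ‖x‖) ^ 2) :=
          (hback n).trans (by gcongr; exact hsecond n)
      _ = (K + ‖T‖ * (25 / 7 * C)) * ‖x‖ ^ 2 * ((5 / 2) ^ n * ((3 / 5) ^ n) ^ 2) := by ring
      _ = _ := by
        rw [← pow_mul, mul_comm n 2, pow_mul, ← mul_pow]; norm_num
  have hlim : Tendsto (fun n : ℕ => (K + ‖T‖ * (25 / 7 * C)) * ‖x‖ ^ 2 * (9 / 10 : ℝ) ^ n)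
      atTop (𝓝 0) := by
    simpa using (tendsto_pow_atTop_nhds_zero_of_lt_one (r := (9 / 10 : ℝ)) (by norm_num)
      (by norm_num)).const_mul ((K + ‖T‖ * (25 / 7 * C)) * ‖x‖ ^ 2)
  exact norm_le_zero_iff.1 (ge_of_tendsto' hlim hbound)

/-- Conversely, the linearization maps the zero set of `f` into `ker T`. Write `u = koenigs t x` as
`y + z` with `y ∈ ker T` and `z` bounded by `T u`. Dividing `x` by the point with linearization `y`
gives another zero `w` of `f`, and `w` agrees with `z` to first order, so `T z` is much smaller
than `z`; this forces `z = 0`. -/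
theorem eventually_koenigs_mem_ker_of_eq_zero [CompleteSpace F] {f : E → F} {T : E →L[ℝ] F}
    {t : E → E} {d : E × E → E}
    (ht : IsHalving t) (hf0 : f 0 = 0) (hT : HasFDerivAt f T 0)
    (hcl : IsClosed (Set.range T))
    (hd : HasStrictFDerivAt d (ContinuousLinearMap.fst ℝ E E - ContinuousLinearMap.snd ℝ E E) 0)
    (hdd : ∀ᶠ x in 𝓝 (0 : E), d (x, x) = 0)
    (hfd : ∀ᶠ q in 𝓝 (0 : E × E), f q.1 = 0 → f q.2 = 0 → f (d q) = 0)
    (hker : ∀ᶠ x in 𝓝 0, T (koenigs t x) = 0 → f x = 0) :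
    ∀ᶠ x in 𝓝 0, f x = 0 → T (koenigs t x) = 0 := by
  obtain ⟨r, C₀, H⟩ := ht.exists_halvingOn
  -- A bounded, possibly nonlinear right inverse of `T` on its closed range replaces a complement
  -- of `ker T`.
  obtain ⟨C, hC, g, hg⟩ : ∃ C > 0, ∃ g : E → E, ∀ u, T (g u) = T u ∧ ‖g u‖ ≤ C * ‖T u‖ := by
    have hcl' : IsClosed ((LinearMap.range (T : E →ₗ[ℝ] F) : Submodule ℝ F) : Set F) := by
      rwa [LinearMap.coe_range]
    have : CompleteSpace (LinearMap.range (T : E →ₗ[ℝ] F)) := hcl'.completeSpace_coe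
    let T' : E →L[ℝ] LinearMap.range (T : E →ₗ[ℝ] F) :=
      T.codRestrict _ fun x => LinearMap.mem_range_self _ x
    have hsurj : Function.Surjective T' := by
      rintro ⟨_, x, rfl⟩
      exact ⟨x, rfl⟩
    obtain ⟨C, hC, h⟩ := T'.exists_preimage_norm_le hsurj
    choose g hg using h
    refine ⟨C, hC, fun u => g (T' u), fun u => ⟨congrArg Subtype.val (hg (T' u)).1, ?_⟩⟩
    exact (hg (T' u)).2
  have hψ : HasStrictFDerivAt (koenigs t) ((ContinuousLinearEquiv.refl ℝ E : E ≃L[ℝ] E) : E →L[ℝ] E)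
      0 := by
    refine (H.contDiffAt_koenigs ht (by simpa using H.pos)).hasStrictFDerivAt' ?_ (by simp)
    exact H.hasFDerivAt_koenigs_zero
  set φ := hψ.localInverse (koenigs t) _ 0 with hφdef
  have hψ0 := H.koenigs_zero
  have hφ : HasStrictFDerivAt φ (ContinuousLinearMap.id ℝ E) 0 := by
    have := hψ.to_localInverse
    rw [hψ0] at this
    exact this
  have hφ0 : φ 0 = 0 := by
    have := hψ.localInverse_apply_image
    rwa [hψ0] at this
  have hφψ : ∀ᶠ x in 𝓝 0, φ (koenigs t x) = x := hψ.eventually_left_inverse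
  have hψφ : ∀ᶠ y in 𝓝 0, koenigs t (φ y) = y := by
    have := hψ.eventually_right_inverse
    rwa [hψ0] at this
  -- the quotient map in the linearizing coordinates
  set D : E × E → E := fun q => d (φ q.1, φ q.2) with hDdef
  have hD : HasStrictFDerivAt D (ContinuousLinearMap.fst ℝ E E - ContinuousLinearMap.snd ℝ E E)
      0 := by
    have h1 : HasStrictFDerivAt (fun q : E × E => (φ q.1, φ q.2))
        (((ContinuousLinearMap.id ℝ E).comp (ContinuousLinearMap.fst ℝ E E)).prod
          ((ContinuousLinearMap.id ℝ E).comp (ContinuousLinearMap.snd ℝ E E))) 0 :=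
      (HasStrictFDerivAt.comp (0 : E × E) (f := Prod.fst) hφ hasStrictFDerivAt_fst).prodMk
        (HasStrictFDerivAt.comp (0 : E × E) (f := Prod.snd) hφ hasStrictFDerivAt_snd)
    have h0 : (fun q : E × E => (φ q.1, φ q.2)) 0 = 0 := by simp [hφ0]
    refine (HasStrictFDerivAt.comp (0 : E × E) (g := d) (h0.symm ▸ hd) h1).congr_fderiv ?_
    ext <;> simp
  have hD0 : D 0 = 0 := by simpa [hDdef, hφ0] using hdd.self_of_nhds
  -- `ε` is such that `C * (ε * (2 + ‖T‖)) < 1`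
  set ε : ℝ := 1 / (C * (2 + ‖T‖) + 1) with hε
  have hden : 0 < C * (2 + ‖T‖) + 1 := by positivity
  have hε0 : 0 < ε := by positivity
  have hε1 : ε ≤ 1 := by
    rw [hε, div_le_one hden]
    have : 0 ≤ C * (2 + ‖T‖) := by positivity
    linarith
  have hεC : C * (ε * (2 + ‖T‖)) < 1 := by
    rw [hε, div_mul_eq_mul_div, mul_div_assoc', div_lt_one hden]
    linarith
  have hDs := hD.isLittleO.def hε0
  have hTs := hT.isLittleO.def hε0
  simp only [hf0, sub_zero] at hTs
  -- everything below depends on `u = koenigs t x` only, which tends to `0`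
  have hψt : Tendsto (koenigs t) (𝓝 0) (𝓝 0) := by
    simpa only [ContinuousAt, hψ0] using hψ.continuousAt
  have hgt : Tendsto g (𝓝 0) (𝓝 0) := by
    have h1 : Tendsto (fun u => C * ‖T u‖) (𝓝 0) (𝓝 0) :=
      (by fun_prop : Continuous fun u => C * ‖T u‖).tendsto' _ _ (by simp)
    exact squeeze_zero_norm (fun u => (hg u).2) h1
  have hyt : Tendsto (fun u => u - g u) (𝓝 0) (𝓝 0) := by
    simpa using tendsto_id.sub hgt
  have hpair : Tendsto (fun u => (u, u - g u)) (𝓝 0) (𝓝 (0 : E × E)) := by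
    have : Tendsto (fun u => (u, u - g u)) (𝓝 (0 : E)) (𝓝 (0, 0)) := tendsto_id.prodMk_nhds hyt
    exact this
  have hpair' : Tendsto (fun u => (u - g u, u - g u)) (𝓝 0) (𝓝 (0 : E × E)) := by
    have : Tendsto (fun u => (u - g u, u - g u)) (𝓝 (0 : E)) (𝓝 (0, 0)) := hyt.prodMk_nhds hyt
    exact this
  have hφt : Tendsto φ (𝓝 0) (𝓝 0) := by
    simpa only [ContinuousAt, hφ0] using hφ.continuousAt
  have hDt : Tendsto D (𝓝 0) (𝓝 0) := by
    simpa only [ContinuousAt, hD0] using hD.continuousAt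
  have hpφ : Tendsto (fun u => (φ u, φ (u - g u))) (𝓝 0) (𝓝 (0 : E × E)) := by
    have : Tendsto (fun u => (φ u, φ (u - g u))) (𝓝 (0 : E)) (𝓝 (0, 0)) :=
      hφt.prodMk_nhds (hφt.comp hyt)
    exact this
  have e1 := hpair.prodMk_nhds hpair'
  filter_upwards [hφψ, hψt.eventually (e1.eventually hDs),
    hψt.eventually ((hDt.comp hpair).eventually hTs),
    hψt.eventually (hpφ.eventually hfd),
    hψt.eventually ((hφt.comp hyt).eventually hker),
    hψt.eventually ((hφt.comp hyt).eventually hdd),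
    hψt.eventually (hyt.eventually hψφ)] with x h1 h2 h3 h4 h5 h6 h7 hx
  set u := koenigs t x with hu
  obtain ⟨hgu, hgn⟩ := hg u
  simp only [Function.comp_apply] at h3 h5 h6
  have hDyy : D (u - g u, u - g u) = 0 := h6
  have hfy : f (φ (u - g u)) = 0 := h5 (by rw [h7, map_sub, hgu, sub_self])
  have hw : f (D (u, u - g u)) = 0 := h4 (by simpa [h1] using hx) hfy
  rw [hDyy, sub_zero] at h2
  have h2' : ‖D (u, u - g u) - g u‖ ≤ ε * ‖g u‖ := by
    simpa [Prod.norm_def] using h2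
  rw [hw, zero_sub, norm_neg] at h3
  set w := D (u, u - g u) with hwdef
  have hwn : ‖w‖ ≤ 2 * ‖g u‖ := by
    have := norm_le_norm_add_norm_sub (g u) w
    rw [norm_sub_rev] at this
    nlinarith [norm_nonneg (g u)]
  have hTg : ‖T (g u)‖ ≤ ε * (2 + ‖T‖) * ‖g u‖ := by
    have a1 : ‖T (w - g u)‖ ≤ ‖T‖ * (ε * ‖g u‖) :=
      (T.le_opNorm _).trans (by gcongr)
    have a2 := norm_le_norm_add_norm_sub (T w) (T (g u))
    rw [← map_sub] at a2
    have a3 : ε * ‖w‖ ≤ ε * (2 * ‖g u‖) := by gcongr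
    nlinarith
  have hgz : ‖g u‖ ≤ C * (ε * (2 + ‖T‖)) * ‖g u‖ := by
    rw [← hgu] at hgn
    refine hgn.trans ?_
    rw [mul_assoc]
    gcongr
  have : g u = 0 := by
    rw [← norm_le_zero_iff]
    nlinarith [norm_nonneg (g u)]
  rw [← hgu, this, map_zero]

end ZeroSet

/-! ### Smooth maps into closed subspaces -/

section Codomain

/-- A derivative of a map into a closed subspace takes its values in that subspace. -/
theorem LinearIsometry.exists_hasFDerivAt_of_comp {D E₁ E₂ : Type*}
    [NormedAddCommGroup D] [NormedSpace ℝ D]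
    [NormedAddCommGroup E₁] [NormedSpace ℝ E₁] [CompleteSpace E₁]
    [NormedAddCommGroup E₂] [NormedSpace ℝ E₂] (ι : E₁ →ₗᵢ[ℝ] E₂) {f : D → E₁} {x : D}
    {A : D →L[ℝ] E₂} (h : HasFDerivAt (fun y => ι (f y)) A x) :
    ∃ B : D →L[ℝ] E₁, ι.toContinuousLinearMap.comp B = A ∧ HasFDerivAt f B x := by
  have hcl : IsClosed (Set.range ι) := ι.isometry.isClosedEmbedding.isClosed_range
  have hA : ∀ v, A v ∈ Set.range ι := by
    intro v
    have hlim := h.lim v (α := ℕ) (l := atTop) (c := fun n => (n : ℝ))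
      (by simpa using tendsto_natCast_atTop_atTop)
    refine hcl.mem_of_tendsto hlim (.of_forall fun n => ?_)
    exact ⟨(n : ℝ) • (f (x + (n : ℝ)⁻¹ • v) - f x), by simp⟩
  choose b hb using hA
  let B : D →L[ℝ] E₁ := LinearMap.mkContinuous
    { toFun := b
      map_add' := fun v w => ι.injective (by simp [hb])
      map_smul' := fun c v => ι.injective (by simp [hb]) } ‖A‖ (fun v => by
        have : ‖b v‖ = ‖A v‖ := by rw [← hb v, ι.norm_map]
        simpa [this] using A.le_opNorm v)
  have hB : ∀ v, ι (B v) = A v := hb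
  refine ⟨B, ContinuousLinearMap.ext hB, .of_isLittleO ?_⟩
  refine .of_norm_left ((h.isLittleO.norm_left).congr_left fun y => ?_)
  rw [← hB, ← map_sub, ← map_sub, ι.norm_map]

/-- Smoothness of a map into a closed subspace can be tested in the ambient space. No complement
is needed: by induction the derivative, as a map into the closed subspace of operators with values
in the subspace, is of class `C ^ k`. -/
theorem LinearIsometry.contDiffOn_of_comp (k : ℕ) :
    ∀ {D E₁ E₂ : Type u} [NormedAddCommGroup D] [NormedSpace ℝ D]
      [NormedAddCommGroup E₁] [NormedSpace ℝ E₁] [CompleteSpace E₁]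
      [NormedAddCommGroup E₂] [NormedSpace ℝ E₂] (ι : E₁ →ₗᵢ[ℝ] E₂) {f : D → E₁} {s : Set D},
      IsOpen s → ContDiffOn ℝ k (fun x => ι (f x)) s → ContDiffOn ℝ k f s := by
  induction k with
  | zero =>
    intro D E₁ E₂ _ _ _ _ _ _ _ ι f s hs h
    have h' : ContinuousOn (fun x => ι (f x)) s := h.continuousOn
    exact contDiffOn_zero.2 (ι.isometry.isEmbedding.continuousOn_iff.2 h')
  | succ k ih =>
    intro D E₁ E₂ _ _ _ _ _ _ _ ι f s hs h
    have hk : ((k + 1 : ℕ) : WithTop ℕ∞) = (k : WithTop ℕ∞) + 1 := by norm_cast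
    rw [hk, contDiffOn_succ_iff_fderiv_of_isOpen hs] at h ⊢
    obtain ⟨hd, -, hf'⟩ := h
    have key : ∀ x ∈ s, DifferentiableAt ℝ f x ∧
        ι.toContinuousLinearMap.comp (fderiv ℝ f x) = fderiv ℝ (fun x => ι (f x)) x := by
      intro x hx
      obtain ⟨B, hB, hfB⟩ := ι.exists_hasFDerivAt_of_comp
        (hd.differentiableAt (hs.mem_nhds hx)).hasFDerivAt
      exact ⟨hfB.differentiableAt, by rw [hfB.fderiv, hB]⟩
    refine ⟨fun x hx => (key x hx).1.differentiableWithinAt, by simp, ?_⟩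
    -- composition with `ι` is an isometric embedding of the spaces of operators
    exact ih ι.postcomp hs (hf'.congr fun x hx => (key x hx).2)

theorem LinearIsometry.contDiffAt_of_comp {D E₁ E₂ : Type u} [NormedAddCommGroup D]
    [NormedSpace ℝ D] [NormedAddCommGroup E₁] [NormedSpace ℝ E₁] [CompleteSpace E₁]
    [NormedAddCommGroup E₂] [NormedSpace ℝ E₂] (ι : E₁ →ₗᵢ[ℝ] E₂) {f : D → E₁} {x : D}
    (h : ContDiffAt ℝ ∞ (fun y => ι (f y)) x) : ContDiffAt ℝ ∞ f x := by
  refine contDiffAt_infty.2 fun k => ?_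
  obtain ⟨u, hu, hk⟩ := (contDiffAt_infty.1 h k).contDiffOn le_rfl (by simp)
  obtain ⟨v, hvu, hv, hxv⟩ := _root_.mem_nhds_iff.1 (by simpa using hu)
  exact (contDiffOn_of_comp k ι hv (hk.mono hvu)).contDiffAt (hv.mem_nhds hxv)

end Codomain

/-! ### Lie group structures from slice charts -/

section Slice

variable {E : Type u} [NormedAddCommGroup E] [NormedSpace ℝ E]
variable {G : Type v} [Group G] [TopologicalSpace G]

open Classical in
/-- The chart of a subgroup `H` with values in a subspace `V` that is induced by a slice chart `e`
of the ambient group, that is, a chart in which `H` corresponds to `V`. Outside its source and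
target it takes arbitrary values. -/
noncomputable def sliceChart (H : Subgroup G) (V : Submodule ℝ E) (e : OpenPartialHomeomorph G E)
    (he : ∀ g ∈ e.source, g ∈ H ↔ e g ∈ V) : OpenPartialHomeomorph H V where
  toFun g := if hg : e g ∈ V then ⟨e g, hg⟩ else 0
  invFun x := if hx : e.symm x ∈ H then ⟨e.symm x, hx⟩ else 1
  source := Subtype.val ⁻¹' e.source
  target := Subtype.val ⁻¹' e.target
  map_source' := by
    intro g hg
    have h1 : e g ∈ V := (he g hg).1 g.2
    simpa [h1] using e.map_source hg
  map_target' := by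
    intro x hx
    have h1 : e.symm x ∈ H := (he _ (e.map_target hx)).2 (by simp [e.right_inv hx])
    simpa [h1] using e.map_target hx
  left_inv' := by
    intro g hg
    have h1 : e g ∈ V := (he g hg).1 g.2
    simp [h1, e.left_inv hg]
  right_inv' := by
    intro x hx
    have h1 : e.symm x ∈ H := (he _ (e.map_target hx)).2 (by simp [e.right_inv hx])
    simp [h1, e.right_inv hx]
  open_source := e.open_source.preimage continuous_subtype_val
  open_target := e.open_target.preimage continuous_subtype_val
  continuousOn_toFun := by
    rw [IsInducing.subtypeVal.continuousOn_iff]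
    refine (e.continuousOn.comp continuous_subtype_val.continuousOn fun g hg => hg).congr ?_
    intro g hg
    have h1 : e g ∈ V := (he g hg).1 g.2
    simp [h1]
  continuousOn_invFun := by
    rw [IsInducing.subtypeVal.continuousOn_iff]
    refine (e.continuousOn_symm.comp continuous_subtype_val.continuousOn fun g hg => hg).congr ?_
    intro x hx
    have h1 : e.symm x ∈ H := (he _ (e.map_target hx)).2 (by simp [e.right_inv hx])
    simp [h1]

variable {H : Subgroup G} {V : Submodule ℝ E}

theorem coe_sliceChart {e : OpenPartialHomeomorph G E} (he : ∀ g ∈ e.source, g ∈ H ↔ e g ∈ V)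
    {g : H} (hg : (g : G) ∈ e.source) : (sliceChart H V e he g : E) = e g := by
  have h1 : e g ∈ V := (he g hg).1 g.2
  simp [sliceChart, h1]

theorem coe_sliceChart_symm {e : OpenPartialHomeomorph G E}
    (he : ∀ g ∈ e.source, g ∈ H ↔ e g ∈ V) {x : V} (hx : (x : E) ∈ e.target) :
    ((sliceChart H V e he).symm x : G) = e.symm x := by
  have h1 : e.symm x ∈ H := (he _ (e.map_target hx)).2 (by simp [e.right_inv hx])
  simp [sliceChart, h1]

/-- The charted space structure on a subgroup given by a family of slice charts. -/
@[reducible]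
noncomputable def sliceChartedSpace (e : H → OpenPartialHomeomorph G E)
    (hk : ∀ k : H, (k : G) ∈ (e k).source) (he : ∀ k, ∀ g ∈ (e k).source, g ∈ H ↔ e k g ∈ V) :
    ChartedSpace V H where
  atlas := Set.range fun k => sliceChart H V (e k) (he k)
  chartAt k := sliceChart H V (e k) (he k)
  mem_chart_source k := hk k
  chart_mem_atlas k := ⟨k, rfl⟩

theorem ContMDiffAt.of_subtype_comp [CompleteSpace V] {D : Type u} [NormedAddCommGroup D]
    [NormedSpace ℝ D] {B : Type*} [TopologicalSpace B] {I : ModelWithCorners ℝ D B}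
    [I.Boundaryless] {N : Type*} [TopologicalSpace N] [ChartedSpace B N] {f : N → V} {x : N}
    (h : ContMDiffAt I 𝓘(ℝ, E) ∞ (fun y => (f y : E)) x) : ContMDiffAt I 𝓘(ℝ, V) ∞ f x := by
  rw [contMDiffAt_iff] at h ⊢
  refine ⟨IsInducing.subtypeVal.continuousAt_iff.2 h.1, ?_⟩
  have h2 := h.2
  simp only [extChartAt_model_space_eq_id, PartialEquiv.refl_coe, Function.id_comp,
    I.range_eq_univ, contDiffWithinAt_univ] at h2 ⊢
  exact LinearIsometry.contDiffAt_of_comp V.subtypeₗᵢ h2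

variable [ChartedSpace E G] [CompleteSpace V]

theorem isManifold_sliceChartedSpace [IsManifold 𝓘(ℝ, E) ∞ G] (e : H → OpenPartialHomeomorph G E)
    (hk : ∀ k : H, (k : G) ∈ (e k).source) (he : ∀ k, ∀ g ∈ (e k).source, g ∈ H ↔ e k g ∈ V)
    (hmax : ∀ k, e k ∈ IsManifold.maximalAtlas 𝓘(ℝ, E) ∞ G) :
    letI := sliceChartedSpace e hk he
    IsManifold 𝓘(ℝ, V) ∞ H := by
  let := sliceChartedSpace e hk he
  refine isManifold_of_contDiffOn _ _ _ ?_
  rintro _ _ ⟨k, rfl⟩ ⟨l, rfl⟩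
  intro x hx
  simp only [modelWithCornersSelf_coe, modelWithCornersSelf_coe_symm, Set.preimage_id,
    Set.range_id, Set.inter_univ, Function.id_comp, Function.comp_id] at hx ⊢
  have hopen := ((sliceChart H V (e k) (he k)).symm ≫ₕ sliceChart H V (e l) (he l)).open_source
  refine ContDiffAt.contDiffWithinAt (LinearIsometry.contDiffAt_of_comp V.subtypeₗᵢ ?_)
  have hmem : ∀ y ∈ ((sliceChart H V (e k) (he k)).symm ≫ₕ sliceChart H V (e l) (he l)).source,
      (y : E) ∈ (e k).target ∧ (e k).symm y ∈ (e l).source := by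
    intro y hy
    rw [OpenPartialHomeomorph.trans_source] at hy
    have h1 : (y : E) ∈ (e k).target := hy.1
    have h2 : ((sliceChart H V (e k) (he k)).symm y : G) ∈ (e l).source := hy.2
    rw [coe_sliceChart_symm (he k) h1] at h2
    exact ⟨h1, h2⟩
  have hsm : ContDiffAt ℝ ∞ (fun y : E => e l ((e k).symm y)) x := by
    rw [← contMDiffAt_iff_contDiffAt]
    exact (contMDiffAt_of_mem_maximalAtlas (hmax l) (hmem x hx).2).comp (x : E)
      (contMDiffAt_symm_of_mem_maximalAtlas (hmax k) (hmem x hx).1)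
  refine (hsm.comp x V.subtypeL.contDiff.contDiffAt).congr_of_eventuallyEq ?_
  filter_upwards [hopen.mem_nhds hx] with y hy
  have h2 := hmem y hy
  have h3 : ((sliceChart H V (e k) (he k)).symm y : G) ∈ (e l).source := by
    rw [coe_sliceChart_symm (he k) h2.1]; exact h2.2
  change ((sliceChart H V (e l) (he l) ((sliceChart H V (e k) (he k)).symm y) : V) : E) = _
  rw [coe_sliceChart (he l) h3, coe_sliceChart_symm (he k) h2.1]
  rfl

theorem contMDiff_subtype_val_slice [IsManifold 𝓘(ℝ, E) ∞ G] (e : H → OpenPartialHomeomorph G E)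
    (hk : ∀ k : H, (k : G) ∈ (e k).source) (he : ∀ k, ∀ g ∈ (e k).source, g ∈ H ↔ e k g ∈ V)
    (hmax : ∀ k, e k ∈ IsManifold.maximalAtlas 𝓘(ℝ, E) ∞ G) :
    letI := sliceChartedSpace e hk he
    ContMDiff 𝓘(ℝ, V) 𝓘(ℝ, E) ∞ (Subtype.val : H → G) := by
  let := sliceChartedSpace e hk he
  have := isManifold_sliceChartedSpace e hk he hmax
  intro k
  have h1 : ContMDiffAt 𝓘(ℝ, V) 𝓘(ℝ, V) ∞ (sliceChart H V (e k) (he k)) k :=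
    contMDiffAt_of_mem_maximalAtlas (IsManifold.chart_mem_maximalAtlas k) (hk k)
  have h2 : ContMDiffAt 𝓘(ℝ, V) 𝓘(ℝ, E) ∞ (fun g : H => (sliceChart H V (e k) (he k) g : E)) k :=
    ContMDiffAt.comp k V.subtypeL.contMDiff.contMDiffAt h1
  have h3 : ContMDiffAt 𝓘(ℝ, E) 𝓘(ℝ, E) ∞ (e k).symm (sliceChart H V (e k) (he k) k : E) := by
    rw [coe_sliceChart (he k) (hk k)]
    exact contMDiffAt_symm_of_mem_maximalAtlas (hmax k) ((e k).map_source (hk k))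
  refine (ContMDiffAt.comp k h3 h2).congr_of_eventuallyEq ?_
  have : (Subtype.val ⁻¹' (e k).source : Set H) ∈ 𝓝 k :=
    ((e k).open_source.preimage continuous_subtype_val).mem_nhds (hk k)
  filter_upwards [this] with g hg
  simp only [Function.comp_apply]
  rw [coe_sliceChart (he k) hg, (e k).left_inv hg]

/-- The universal property of the slice structure as an initial submanifold. -/
theorem contMDiff_of_subtype_val_comp_slice
    (e : H → OpenPartialHomeomorph G E)
    (hk : ∀ k : H, (k : G) ∈ (e k).source) (he : ∀ k, ∀ g ∈ (e k).source, g ∈ H ↔ e k g ∈ V)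
    (hmax : ∀ k, e k ∈ IsManifold.maximalAtlas 𝓘(ℝ, E) ∞ G)
    {D : Type u} [NormedAddCommGroup D]
    [NormedSpace ℝ D] {B : Type*} [TopologicalSpace B] {I : ModelWithCorners ℝ D B}
    [I.Boundaryless] {N : Type*} [TopologicalSpace N] [ChartedSpace B N] {f : N → H}
    (h : ContMDiff I 𝓘(ℝ, E) ∞ (fun y => (f y : G))) :
    letI := sliceChartedSpace e hk he
    ContMDiff I 𝓘(ℝ, V) ∞ f := by
  let := sliceChartedSpace e hk he
  intro x
  have hc : ContinuousAt f x := IsInducing.subtypeVal.continuousAt_iff.2 (h x).continuousAt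
  refine contMDiffAt_iff_target.2 ⟨hc, ContMDiffAt.of_subtype_comp ?_⟩
  have h1 : ContMDiffAt I 𝓘(ℝ, E) ∞ (fun y => e (f x) (f y : G)) x :=
    ContMDiffAt.comp x (contMDiffAt_of_mem_maximalAtlas (hmax (f x)) (hk (f x))) (h x)
  refine h1.congr_of_eventuallyEq ?_
  have : (Subtype.val ⁻¹' (e (f x)).source : Set H) ∈ 𝓝 (f x) :=
    ((e (f x)).open_source.preimage continuous_subtype_val).mem_nhds (hk (f x))
  filter_upwards [hc.eventually this] with y hy
  simp only [extChartAt, mfld_simps]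
  exact coe_sliceChart (he (f x)) hy

end Slice

/-- A subgroup of a Lie group with one slice chart at the identity, modelled on a closed but not
necessarily complemented subspace, is a Lie group: translates of the slice chart form an atlas. -/
theorem isBanachLieGroup_of_slice {E : Type u} [NormedAddCommGroup E] [NormedSpace ℝ E]
    {G : Type v} [Group G] [TopologicalSpace G] [ChartedSpace E G]
    [LieGroup 𝓘(ℝ, E) ∞ G] (H : Subgroup G) (V : Submodule ℝ E) [CompleteSpace V]
    (e : OpenPartialHomeomorph G E) (he : e ∈ IsManifold.maximalAtlas 𝓘(ℝ, E) ∞ G)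
    (h1 : (1 : G) ∈ e.source) (hH : ∀ g ∈ e.source, g ∈ H ↔ e g ∈ V) :
    IsBanachLieGroup.{u, v} H := by
  have : IsTopologicalGroup G := topologicalGroup_of_lieGroup 𝓘(ℝ, E) ∞
  let c : H → OpenPartialHomeomorph G E := fun k =>
    (Homeomorph.mulLeft (k : G)⁻¹).toOpenPartialHomeomorph ≫ₕ e
  have hsrc : ∀ k g, g ∈ (c k).source ↔ (k : G)⁻¹ * g ∈ e.source := by
    intro k g
    simp [c]
  have hk : ∀ k : H, (k : G) ∈ (c k).source := fun k => by rw [hsrc]; simpa using h1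
  have hc : ∀ k, ∀ g ∈ (c k).source, g ∈ H ↔ c k g ∈ V := by
    intro k g hg
    have h2 := hH _ ((hsrc k g).1 hg)
    rw [H.mul_mem_cancel_left (H.inv_mem k.2)] at h2
    simpa [c] using h2
  have hmax : ∀ k, c k ∈ IsManifold.maximalAtlas 𝓘(ℝ, E) ∞ G := by
    intro k
    refine OpenPartialHomeomorph.mem_maximalAtlas_of_contMDiffOn _ ?_ ?_
    · refine (contMDiffOn_of_mem_maximalAtlas he).comp
        (contMDiff_mul_left (I := 𝓘(ℝ, E)) (a := (k : G)⁻¹)).contMDiffOn fun g hg => (hsrc k g).1 hg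
    · refine (contMDiff_mul_left (I := 𝓘(ℝ, E)) (a := (k : G))).comp_contMDiffOn
        ((contMDiffOn_symm_of_mem_maximalAtlas he).mono fun x hx => ?_) |>.congr fun x hx => ?_
      · simpa [c] using hx
      · simp [c, Homeomorph.mulLeft_symm]
  let := sliceChartedSpace c hk hc
  have hM := isManifold_sliceChartedSpace c hk hc hmax
  have hval := contMDiff_subtype_val_slice c hk hc hmax
  refine ⟨V, inferInstance, inferInstance, inferInstance, this, ?_⟩
  exact
    { hM with
      contMDiff_mul := contMDiff_of_subtype_val_comp_slice c hk hc hmax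
        ((hval.comp contMDiff_fst).mul (hval.comp contMDiff_snd))
      contMDiff_inv := contMDiff_of_subtype_val_comp_slice c hk hc hmax hval.inv }

/-! ### Local inverses and centred charts -/

section LocalCoordinates

/-- The inverse function theorem, on a domain on which both the map and its inverse are smooth at
every point (`ContDiffAt ℝ ∞` at one point does not imply it nearby). -/
theorem exists_openPartialHomeomorph_of_contDiffAt {E F : Type*}
    [NormedAddCommGroup E] [NormedSpace ℝ E] [CompleteSpace E]
    [NormedAddCommGroup F] [NormedSpace ℝ F] {f : E → F} {a : E} (f' : E ≃L[ℝ] F)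
    (hf : ∀ᶠ x in 𝓝 a, ContDiffAt ℝ ∞ f x) (hf' : HasFDerivAt f (f' : E →L[ℝ] F) a) :
    ∃ e : OpenPartialHomeomorph E F, (e : E → F) = f ∧ a ∈ e.source ∧
      (∀ x ∈ e.source, ContDiffAt ℝ ∞ f x) ∧ ∀ y ∈ e.target, ContDiffAt ℝ ∞ e.symm y := by
  have h0 := hf.self_of_nhds
  let e₀ := h0.toOpenPartialHomeomorph f hf' (by simp)
  have hinv : ∀ᶠ x in 𝓝 a,
      fderiv ℝ f x ∈ Set.range (ContinuousLinearEquiv.toContinuousLinearMap : (E ≃L[ℝ] F) → _) := by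
    refine (h0.fderiv_right (m := 0) (by simp)).continuousAt.eventually
      (ContinuousLinearEquiv.isOpen.mem_nhds ?_)
    rw [hf'.fderiv]
    exact ⟨f', rfl⟩
  obtain ⟨U, hU, hUo, haU⟩ := _root_.eventually_nhds_iff.1 (hf.and hinv)
  let e := e₀.restrOpen U hUo
  refine ⟨e, rfl, ⟨h0.mem_toOpenPartialHomeomorph_source hf' (by simp), haU⟩,
    fun x hx => (hU x hx.2).1, fun y hy => ?_⟩
  have hy' := (e.map_target hy).2
  obtain ⟨L, hL⟩ := (hU _ hy').2
  refine e.contDiffAt_symm hy (f₀' := L) ?_ (hU _ hy').1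
  rw [hL]
  exact ((hU _ hy').1.differentiableAt (by simp)).hasFDerivAt

/-- A map with derivative `2` at a fixed point has a halving map as its local inverse. -/
theorem exists_isHalving_of_hasFDerivAt_two {E : Type*} [NormedAddCommGroup E] [NormedSpace ℝ E]
    [CompleteSpace E] {s : E → E} (hs : ∀ᶠ x in 𝓝 0, ContDiffAt ℝ ∞ s x) (hs0 : s 0 = 0)
    (hs' : HasFDerivAt s ((2 : ℝ) • ContinuousLinearMap.id ℝ E) 0) :
    ∃ t : E → E, IsHalving t ∧ ∀ᶠ x in 𝓝 0, s (t x) = x := by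
  let L : E ≃L[ℝ] E := ContinuousLinearEquiv.smulLeft (Units.mk0 (2 : ℝ) two_ne_zero)
  have hL : (L : E →L[ℝ] E) = (2 : ℝ) • ContinuousLinearMap.id ℝ E := by
    ext x; rfl
  obtain ⟨e, he, h0, h1, h2⟩ := exists_openPartialHomeomorph_of_contDiffAt L hs (by rwa [hL])
  have h0t : (0 : E) ∈ e.target := by
    have := e.map_source h0
    rwa [he, hs0] at this
  have he0 : e.symm 0 = 0 := by
    have := e.left_inv h0
    rwa [he, hs0] at this
  refine ⟨e.symm, ⟨?_, he0, ?_⟩, ?_⟩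
  · filter_upwards [e.open_target.mem_nhds h0t] with y hy using h2 y hy
  · have := e.hasFDerivAt_symm (f' := L) h0t (by rwa [he0, he, hL])
    refine this.congr_fderiv ?_
    ext x
    rw [← L.injective.eq_iff]
    change L (L.symm x) = (2 : ℝ) • ((1 / 2 : ℝ) • x)
    simp [smul_smul]
  · filter_upwards [e.open_target.mem_nhds h0t] with y hy
    rw [← he]
    exact e.right_inv hy

theorem exists_centered_chart {E : Type*} [NormedAddCommGroup E] [NormedSpace ℝ E]
    {N : Type*} [TopologicalSpace N] [ChartedSpace E N] [IsManifold 𝓘(ℝ, E) ∞ N] (a : N) :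
    ∃ c ∈ IsManifold.maximalAtlas 𝓘(ℝ, E) ∞ N, a ∈ c.source ∧ c a = 0 := by
  let c₀ := chartAt E a
  have hc₀ : c₀ ∈ IsManifold.maximalAtlas 𝓘(ℝ, E) ∞ N := IsManifold.chart_mem_maximalAtlas a
  let c := c₀ ≫ₕ (Homeomorph.addRight (-(c₀ a))).toOpenPartialHomeomorph
  refine ⟨c, OpenPartialHomeomorph.mem_maximalAtlas_of_contMDiffOn _ ?_ ?_, ?_, ?_⟩
  · have h1 : ContMDiff 𝓘(ℝ, E) 𝓘(ℝ, E) ∞ (fun x : E => x + -(c₀ a)) :=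
      (contDiff_id.add contDiff_const).contMDiff
    refine (h1.comp_contMDiffOn ((contMDiffOn_of_mem_maximalAtlas hc₀).mono fun x hx => ?_)).congr
      fun x hx => ?_
    · simpa [c, Homeomorph.addRight_symm] using hx
    · simp [c]
  · have h1 : ContMDiff 𝓘(ℝ, E) 𝓘(ℝ, E) ∞ (fun x : E => x + c₀ a) :=
      (contDiff_id.add contDiff_const).contMDiff
    refine ((contMDiffOn_symm_of_mem_maximalAtlas hc₀).comp h1.contMDiffOn fun x hx => ?_).congr
      fun x hx => ?_
    · simpa [c, Homeomorph.addRight_symm] using hx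
    · simp [c, Homeomorph.addRight_symm]
  · simp [c, c₀]
  · simp [c]

theorem OpenPartialHomeomorph.trans_mem_maximalAtlas {E : Type*} [NormedAddCommGroup E]
    [NormedSpace ℝ E] {N : Type*} [TopologicalSpace N] [ChartedSpace E N]
    [IsManifold 𝓘(ℝ, E) ∞ N] {c : OpenPartialHomeomorph N E}
    (hc : c ∈ IsManifold.maximalAtlas 𝓘(ℝ, E) ∞ N) {e : OpenPartialHomeomorph E E}
    (he : ∀ x ∈ e.source, ContDiffAt ℝ ∞ e x) (he' : ∀ y ∈ e.target, ContDiffAt ℝ ∞ e.symm y) :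
    c ≫ₕ e ∈ IsManifold.maximalAtlas 𝓘(ℝ, E) ∞ N := by
  refine OpenPartialHomeomorph.mem_maximalAtlas_of_contMDiffOn _ (fun g hg => ?_) (fun x hx => ?_)
  · rw [OpenPartialHomeomorph.trans_source] at hg
    exact ((he _ hg.2).contMDiffAt.comp g
      (contMDiffAt_of_mem_maximalAtlas hc hg.1)).contMDiffWithinAt
  · rw [OpenPartialHomeomorph.trans_target] at hx
    exact ((contMDiffAt_symm_of_mem_maximalAtlas hc hx.2).comp x
      (he' _ hx.1).contMDiffAt).contMDiffWithinAt

end LocalCoordinates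

/-! ### Group operations and actions in charts -/

section ChartedOperations

/-- A map that is linear along a subspace has that linear map as its derivative there. -/
theorem HasFDerivAt.apply_eq_of_eventually {X Y Z : Type*} [NormedAddCommGroup X] [NormedSpace ℝ X]
    [NormedAddCommGroup Y] [NormedSpace ℝ Y] [NormedAddCommGroup Z] [NormedSpace ℝ Z]
    {d : X → Y} {L : X →L[ℝ] Y} (h : HasFDerivAt d L 0) (j : Z →L[ℝ] X) (g : Z →L[ℝ] Y)
    (hj : ∀ᶠ z in 𝓝 0, d (j z) = g z) (z : Z) : L (j z) = g z := by
  have h1 : HasFDerivAt (fun z => d (j z)) (L.comp j) 0 :=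
    HasFDerivAt.comp (0 : Z) (by simpa using h) j.hasFDerivAt
  have h2 : HasFDerivAt (fun z => d (j z)) g 0 := g.hasFDerivAt.congr_of_eventuallyEq hj
  exact DFunLike.congr_fun (h1.unique h2) z

theorem tendsto_symm_of_centered {E G : Type*} [NormedAddCommGroup E] [Group G]
    [TopologicalSpace G] {c : OpenPartialHomeomorph G E} (h1 : (1 : G) ∈ c.source)
    (hc1 : c 1 = 0) : Tendsto c.symm (𝓝 0) (𝓝 1) := by
  have h := c.continuousAt_symm (c.map_source h1)
  rwa [ContinuousAt, c.left_inv h1, hc1] at h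

variable {E : Type*} [NormedAddCommGroup E] [NormedSpace ℝ E]
  {G : Type*} [Group G] [TopologicalSpace G] [ChartedSpace E G]
  {c : OpenPartialHomeomorph G E}
  {E' : Type*} [NormedAddCommGroup E'] [NormedSpace ℝ E']
  {M : Type*} [TopologicalSpace M] [ChartedSpace E' M]
  [MulAction G M] [ContMDiffSMul 𝓘(ℝ, E) 𝓘(ℝ, E') ∞ G M] {p : M} {b : OpenPartialHomeomorph M E'}

theorem contDiffAt_action_in_chart (hc : c ∈ IsManifold.maximalAtlas 𝓘(ℝ, E) ∞ G)
    (h1 : (1 : G) ∈ c.source) (hc1 : c 1 = 0) (hb : b ∈ IsManifold.maximalAtlas 𝓘(ℝ, E') ∞ M)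
    (hp : p ∈ b.source) (hbp : b p = 0) :
    ContDiffAt ℝ ∞ (fun q : E × E' => b (c.symm q.1 • b.symm q.2)) 0 := by
  have h0 : (0 : E) ∈ c.target := hc1 ▸ c.map_source h1
  have h0' : (0 : E') ∈ b.target := hbp ▸ b.map_source hp
  have hs0 : c.symm 0 = 1 := by rw [← hc1, c.left_inv h1]
  have hs0' : b.symm 0 = p := by rw [← hbp, b.left_inv hp]
  have hA : ContMDiffAt 𝓘(ℝ, E × E') 𝓘(ℝ, E) ∞ (fun q : E × E' => c.symm q.1) 0 :=
    ContMDiffAt.comp (0 : E × E') (g := c.symm) (f := Prod.fst)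
      (contMDiffAt_symm_of_mem_maximalAtlas hc h0) contDiffAt_fst.contMDiffAt
  have hB : ContMDiffAt 𝓘(ℝ, E × E') 𝓘(ℝ, E') ∞ (fun q : E × E' => b.symm q.2) 0 :=
    ContMDiffAt.comp (0 : E × E') (g := b.symm) (f := Prod.snd)
      (contMDiffAt_symm_of_mem_maximalAtlas hb h0') contDiffAt_snd.contMDiffAt
  rw [← contMDiffAt_iff_contDiffAt]
  refine ContMDiffAt.comp (0 : E × E') (g := b) ?_ (hA.smul hB)
  exact contMDiffAt_of_mem_maximalAtlas hb (by simpa [hs0, hs0'] using hp)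

/-- Passing from `g` to `g ^ 2` increases the displacement of `p` by a factor of about `2`: the
displacement of `g • (g • p)` from `g • p` is almost that of `g • p` from `p`. -/
theorem norm_orbit_sq_le (hc : c ∈ IsManifold.maximalAtlas 𝓘(ℝ, E) ∞ G)
    (h1 : (1 : G) ∈ c.source) (hc1 : c 1 = 0) (hb : b ∈ IsManifold.maximalAtlas 𝓘(ℝ, E') ∞ M)
    (hp : p ∈ b.source) (hbp : b p = 0) :
    ∀ᶠ x in 𝓝 0, ‖b ((c.symm x * c.symm x) • p)‖ ≤ 5 / 2 * ‖b (c.symm x • p)‖ := by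
  have : ContinuousSMul G M := ContMDiffSMul.continuousSMul (I := 𝓘(ℝ, E)) (I' := 𝓘(ℝ, E')) ∞
  have h0' : (0 : E') ∈ b.target := hbp ▸ b.map_source hp
  have hs0 : c.symm 0 = 1 := by rw [← hc1, c.left_inv h1]
  have hs0' : b.symm 0 = p := by rw [← hbp, b.left_inv hp]
  have hL := (contDiffAt_action_in_chart hc h1 hc1 hb hp hbp).hasStrictFDerivAt (by simp)
  set a := fun q : E × E' => b (c.symm q.1 • b.symm q.2) with ha
  set L := fderiv ℝ a 0
  have hr := hL.hasFDerivAt.apply_eq_of_eventually (ContinuousLinearMap.inr ℝ E E')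
    (ContinuousLinearMap.id ℝ E') (by
      filter_upwards [b.open_target.mem_nhds h0'] with x hx
      simp [ha, hs0, b.right_inv hx])
  have hbound := hL.isLittleO.def (c := 1 / 2) (by norm_num)
  have horb : Tendsto (fun x => c.symm x • p) (𝓝 0) (𝓝 p) := by
    simpa using (tendsto_symm_of_centered h1 hc1).smul (tendsto_const_nhds (x := p))
  have hf : Tendsto (fun x => b (c.symm x • p)) (𝓝 0) (𝓝 0) := by
    have := (b.continuousAt hp).tendsto
    rw [hbp] at this
    exact this.comp horb
  have hpair : Tendsto (fun x => ((x, b (c.symm x • p)), ((x, 0) : E × E'))) (𝓝 0)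
      (𝓝 ((0 : E × E'), (0 : E × E'))) :=
    (tendsto_id.prodMk_nhds hf).prodMk_nhds (tendsto_id.prodMk_nhds tendsto_const_nhds)
  filter_upwards [hpair.eventually hbound, horb.eventually (b.open_source.mem_nhds hp)] with x hx hxs
  set y := b (c.symm x • p) with hy
  have e1 : a (x, y) = b ((c.symm x * c.symm x) • p) := by
    simp only [ha, hy]
    rw [b.left_inv hxs, mul_smul]
  have e2 : a (x, 0) = y := by simp only [ha, hy, hs0']
  have e3 : ((x, y) : E × E') - (x, 0) = ContinuousLinearMap.inr ℝ E E' y := by simp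
  simp only [e1, e2, e3, hr] at hx
  have e4 : ‖ContinuousLinearMap.inr ℝ E E' y‖ = ‖y‖ := by simp [Prod.norm_def]
  rw [e4, ContinuousLinearMap.id_apply] at hx
  have e5 := norm_add_le (b ((c.symm x * c.symm x) • p) - y - y) (y + y)
  have e6 := norm_add_le y y
  rw [show b ((c.symm x * c.symm x) • p) - y - y + (y + y) = b ((c.symm x * c.symm x) • p) by abel]
    at e5
  linarith

/-- In charts the derivative of the orbit map at the identity has the same range as
`x ↦ derivedAction x p`, up to an isomorphism of the target. -/
theorem isClosed_range_fderiv_orbit (hc : c ∈ IsManifold.maximalAtlas 𝓘(ℝ, E) ∞ G)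
    (h1 : (1 : G) ∈ c.source) (hc1 : c 1 = 0) (hb : b ∈ IsManifold.maximalAtlas 𝓘(ℝ, E') ∞ M)
    (hp : p ∈ b.source) {T : E →L[ℝ] E'}
    (hT : HasFDerivAt (fun x => b (c.symm x • p)) T 0)
    (hclosed : IsClosed (Set.range fun x : GroupLieAlgebra 𝓘(ℝ, E) G =>
      (derivedAction x p : TangentSpace 𝓘(ℝ, E') p))) :
    IsClosed (Set.range T) := by
  have hcd : c.MDifferentiable 𝓘(ℝ, E) 𝓘(ℝ, E) :=
    ⟨(contMDiffOn_of_mem_maximalAtlas hc).mdifferentiableOn (by simp),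
      (contMDiffOn_symm_of_mem_maximalAtlas hc).mdifferentiableOn (by simp)⟩
  have hbd : b.MDifferentiable 𝓘(ℝ, E') 𝓘(ℝ, E') :=
    ⟨(contMDiffOn_of_mem_maximalAtlas hb).mdifferentiableOn (by simp),
      (contMDiffOn_symm_of_mem_maximalAtlas hb).mdifferentiableOn (by simp)⟩
  have hp' : (1 : G) • p ∈ b.source := by rwa [one_smul]
  let A : E ≃L[ℝ] E := hcd.mfderiv h1
  let B : E' ≃L[ℝ] E' := hbd.mfderiv hp'
  let S : E × E' →L[ℝ] E' := mfderiv (𝓘(ℝ, E).prod 𝓘(ℝ, E')) 𝓘(ℝ, E')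
    (fun q : G × M => q.1 • q.2) ((1 : G), p)
  have hσ : HasMFDerivAt (𝓘(ℝ, E).prod 𝓘(ℝ, E')) 𝓘(ℝ, E') (fun q : G × M => q.1 • q.2)
      ((1 : G), p) S :=
    ((contMDiff_smul (I := 𝓘(ℝ, E)) (I' := 𝓘(ℝ, E')) (n := ∞) (G := G) (M := M)
      ((1 : G), p)).mdifferentiableAt (by simp)).hasMFDerivAt
  have hj : HasMFDerivAt 𝓘(ℝ, E) (𝓘(ℝ, E).prod 𝓘(ℝ, E')) (fun g : G => (g, p)) 1
      (ContinuousLinearMap.inl ℝ E E') := by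
    have := (hasMFDerivAt_id (I := 𝓘(ℝ, E)) (1 : G)).prodMk
      (hasMFDerivAt_const (I := 𝓘(ℝ, E)) (I' := 𝓘(ℝ, E')) p (1 : G))
    exact this
  have hF : HasMFDerivAt 𝓘(ℝ, E) 𝓘(ℝ, E') (fun g : G => b (g • p)) 1
      (((B : E' →L[ℝ] E').comp S).comp (ContinuousLinearMap.inl ℝ E E')) :=
    HasMFDerivAt.comp (1 : G) (g := fun q : G × M => b (q.1 • q.2)) (f := fun g : G => (g, p))
      (HasMFDerivAt.comp ((1 : G), p) (hbd.mdifferentiableAt hp').hasMFDerivAt hσ) hj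
  have hF' : HasMFDerivAt 𝓘(ℝ, E) 𝓘(ℝ, E') (fun g : G => b (g • p)) 1
      (T.comp (A : E →L[ℝ] E)) := by
    have hT' : HasFDerivAt (fun x => b (c.symm x • p)) T (c 1) := by rwa [hc1]
    have := hT'.hasMFDerivAt.comp (1 : G) (hcd.mdifferentiableAt h1).hasMFDerivAt
    refine HasMFDerivAt.congr_of_eventuallyEq this ?_
    filter_upwards [c.open_source.mem_nhds h1] with g hg
    simp [c.left_inv hg]
  have hTA : T.comp (A : E →L[ℝ] E) =
      ((B : E' →L[ℝ] E').comp S).comp (ContinuousLinearMap.inl ℝ E E') :=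
    hasMFDerivAt_unique hF' hF
  have hclosed' : IsClosed (Set.range fun x : E => -(S (x, 0))) := hclosed
  have hrange : Set.range T = B '' (Set.range fun x : E => -(S (x, 0))) := by
    have hAB : ∀ x, T (A x) = B (S (x, 0)) := fun x => DFunLike.congr_fun hTA x
    ext y
    constructor
    · rintro ⟨x, rfl⟩
      refine ⟨_, ⟨-(A.symm x), rfl⟩, ?_⟩
      have h2 : ((-(A.symm x), 0) : E × E') = -(A.symm x, 0) := by simp
      change B (-(S (-(A.symm x), 0))) = T x
      rw [map_neg, h2, map_neg, map_neg, neg_neg, ← hAB, A.apply_symm_apply]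
    · rintro ⟨_, ⟨x, rfl⟩, rfl⟩
      exact ⟨-(A x), by rw [map_neg, hAB, map_neg]⟩
  rw [hrange]
  exact B.toHomeomorph.isClosedMap _ hclosed'

variable [LieGroup 𝓘(ℝ, E) ∞ G]

/-- In a chart centred at `1`, division `(x, y) ↦ x * y⁻¹` has derivative `(ξ, η) ↦ ξ - η`, because
`x * 1⁻¹ = x` and `x * x⁻¹ = 1`. -/
theorem division_in_chart (hc : c ∈ IsManifold.maximalAtlas 𝓘(ℝ, E) ∞ G)
    (h1 : (1 : G) ∈ c.source) (hc1 : c 1 = 0) :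
    HasStrictFDerivAt (fun q : E × E => c (c.symm q.1 * (c.symm q.2)⁻¹))
      (ContinuousLinearMap.fst ℝ E E - ContinuousLinearMap.snd ℝ E E) 0 ∧
    ∀ᶠ q in 𝓝 (0 : E × E), c.symm (c (c.symm q.1 * (c.symm q.2)⁻¹)) =
      c.symm q.1 * (c.symm q.2)⁻¹ := by
  have : IsTopologicalGroup G := topologicalGroup_of_lieGroup 𝓘(ℝ, E) ∞
  have h0 : (0 : E) ∈ c.target := hc1 ▸ c.map_source h1
  have hs0 : c.symm 0 = 1 := by rw [← hc1, c.left_inv h1]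
  have ht := tendsto_symm_of_centered h1 hc1
  have hfst : Tendsto (fun q : E × E => c.symm q.1) (𝓝 0) (𝓝 1) :=
    ht.comp (continuous_fst.tendsto' _ _ rfl)
  have hsnd : Tendsto (fun q : E × E => c.symm q.2) (𝓝 0) (𝓝 1) :=
    ht.comp (continuous_snd.tendsto' _ _ rfl)
  have hdiv : Tendsto (fun q : E × E => c.symm q.1 * (c.symm q.2)⁻¹) (𝓝 0) (𝓝 1) := by
    simpa using hfst.mul hsnd.inv
  refine ⟨?_, (hdiv.eventually (c.open_source.mem_nhds h1)).mono fun q hq => c.left_inv hq⟩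
  have hsymm : ContMDiffAt 𝓘(ℝ, E) 𝓘(ℝ, E) ∞ c.symm 0 := contMDiffAt_symm_of_mem_maximalAtlas hc h0
  have hA : ContMDiffAt 𝓘(ℝ, E × E) 𝓘(ℝ, E) ∞ (fun q : E × E => c.symm q.1) 0 :=
    ContMDiffAt.comp (0 : E × E) (g := c.symm) (f := Prod.fst) hsymm
      contDiffAt_fst.contMDiffAt
  have hB : ContMDiffAt 𝓘(ℝ, E × E) 𝓘(ℝ, E) ∞ (fun q : E × E => c.symm q.2) 0 :=
    ContMDiffAt.comp (0 : E × E) (g := c.symm) (f := Prod.snd) hsymm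
      contDiffAt_snd.contMDiffAt
  have hd : ContDiffAt ℝ ∞ (fun q : E × E => c (c.symm q.1 * (c.symm q.2)⁻¹)) 0 := by
    rw [← contMDiffAt_iff_contDiffAt]
    refine ContMDiffAt.comp (0 : E × E) (g := c) ?_ (hA.mul hB.inv)
    exact contMDiffAt_of_mem_maximalAtlas hc (by simpa [hs0] using h1)
  have hL := hd.hasStrictFDerivAt (by simp)
  set L := fderiv ℝ (fun q : E × E => c (c.symm q.1 * (c.symm q.2)⁻¹)) 0
  have hl := hL.hasFDerivAt.apply_eq_of_eventually (ContinuousLinearMap.inl ℝ E E)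
    (ContinuousLinearMap.id ℝ E) (by
      filter_upwards [c.open_target.mem_nhds h0] with x hx
      simp [hs0, c.right_inv hx])
  have hdiag := hL.hasFDerivAt.apply_eq_of_eventually
    ((ContinuousLinearMap.id ℝ E).prod (ContinuousLinearMap.id ℝ E)) (0 : E →L[ℝ] E)
    (.of_forall fun x => by simp [hc1])
  refine hL.congr_fderiv (ContinuousLinearMap.ext fun q => ?_)
  have hq : q = ContinuousLinearMap.inl ℝ E E (q.1 - q.2) +
      ((ContinuousLinearMap.id ℝ E).prod (ContinuousLinearMap.id ℝ E)) q.2 := by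
    ext <;> simp
  rw [hq, map_add, hl, hdiag]
  simp

theorem squaring_in_chart (hc : c ∈ IsManifold.maximalAtlas 𝓘(ℝ, E) ∞ G)
    (h1 : (1 : G) ∈ c.source) (hc1 : c 1 = 0) :
    (∀ᶠ x in 𝓝 0, ContDiffAt ℝ ∞ (fun x => c (c.symm x * c.symm x)) x) ∧
    HasFDerivAt (fun x => c (c.symm x * c.symm x)) ((2 : ℝ) • ContinuousLinearMap.id ℝ E) 0 ∧
    ∀ᶠ x in 𝓝 0, c.symm (c (c.symm x * c.symm x)) = c.symm x * c.symm x := by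
  have : IsTopologicalGroup G := topologicalGroup_of_lieGroup 𝓘(ℝ, E) ∞
  have h0 : (0 : E) ∈ c.target := hc1 ▸ c.map_source h1
  have hs0 : c.symm 0 = 1 := by rw [← hc1, c.left_inv h1]
  have ht := tendsto_symm_of_centered h1 hc1
  have hsq : ∀ᶠ x in 𝓝 0, c.symm x * c.symm x ∈ c.source := by
    have : Tendsto (fun x => c.symm x * c.symm x) (𝓝 0) (𝓝 1) := by simpa using ht.mul ht
    exact this.eventually (c.open_source.mem_nhds h1)
  refine ⟨?_, ?_, hsq.mono fun x hx => c.left_inv hx⟩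
  · filter_upwards [hsq, c.open_target.mem_nhds h0] with x hx hxt
    rw [← contMDiffAt_iff_contDiffAt]
    have hsymm := contMDiffAt_symm_of_mem_maximalAtlas hc hxt
    exact ContMDiffAt.comp x (g := c) (contMDiffAt_of_mem_maximalAtlas hc hx) (hsymm.mul hsymm)
  · have hsymm : ContMDiffAt 𝓘(ℝ, E) 𝓘(ℝ, E) ∞ c.symm 0 :=
      contMDiffAt_symm_of_mem_maximalAtlas hc h0
    have hA : ContMDiffAt 𝓘(ℝ, E × E) 𝓘(ℝ, E) ∞ (fun q : E × E => c.symm q.1) 0 :=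
      ContMDiffAt.comp (0 : E × E) (g := c.symm) (f := Prod.fst) hsymm
        contDiffAt_fst.contMDiffAt
    have hB : ContMDiffAt 𝓘(ℝ, E × E) 𝓘(ℝ, E) ∞ (fun q : E × E => c.symm q.2) 0 :=
      ContMDiffAt.comp (0 : E × E) (g := c.symm) (f := Prod.snd) hsymm
        contDiffAt_snd.contMDiffAt
    have hm : ContDiffAt ℝ ∞ (fun q : E × E => c (c.symm q.1 * c.symm q.2)) 0 := by
      rw [← contMDiffAt_iff_contDiffAt]
      refine ContMDiffAt.comp (0 : E × E) (g := c) ?_ (hA.mul hB)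
      exact contMDiffAt_of_mem_maximalAtlas hc (by simpa [hs0] using h1)
    have hL := (hm.differentiableAt (by simp)).hasFDerivAt
    set L := fderiv ℝ (fun q : E × E => c (c.symm q.1 * c.symm q.2)) 0
    have hl := hL.apply_eq_of_eventually (ContinuousLinearMap.inl ℝ E E)
      (ContinuousLinearMap.id ℝ E) (by
        filter_upwards [c.open_target.mem_nhds h0] with x hx
        simp [hs0, c.right_inv hx])
    have hr := hL.apply_eq_of_eventually (ContinuousLinearMap.inr ℝ E E)
      (ContinuousLinearMap.id ℝ E) (by
        filter_upwards [c.open_target.mem_nhds h0] with x hx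
        simp [hs0, c.right_inv hx])
    let j := (ContinuousLinearMap.id ℝ E).prod (ContinuousLinearMap.id ℝ E)
    have hcomp : HasFDerivAt (fun x => c (c.symm x * c.symm x)) (L.comp j) 0 :=
      HasFDerivAt.comp (0 : E) (g := fun q : E × E => c (c.symm q.1 * c.symm q.2)) (f := j)
        (by simpa using hL) j.hasFDerivAt
    refine hcomp.congr_fderiv (ContinuousLinearMap.ext fun x => ?_)
    have hj : j x = ContinuousLinearMap.inl ℝ E E x + ContinuousLinearMap.inr ℝ E E x := by
      ext <;> simp [j]
    rw [ContinuousLinearMap.comp_apply, hj, map_add, hl, hr]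
    simp [two_smul]

end ChartedOperations

/-! ### Stabilizers -/

theorem theorem4p2
    {E : Type u} [NormedAddCommGroup E] [NormedSpace ℝ E] [CompleteSpace E]
    {G : Type v} [Group G] [TopologicalSpace G] [ChartedSpace E G] [LieGroup 𝓘(ℝ, E) ∞ G]
    {E' : Type w} [NormedAddCommGroup E'] [NormedSpace ℝ E'] [CompleteSpace E']
    {M : Type z} [TopologicalSpace M] [ChartedSpace E' M] [IsManifold 𝓘(ℝ, E') ∞ M]
    [MulAction G M] [ContMDiffSMul 𝓘(ℝ, E) 𝓘(ℝ, E') ∞ G M]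
    (p : M)
    (hclosed : IsClosed (Set.range fun x : GroupLieAlgebra 𝓘(ℝ, E) G =>
      (derivedAction x p : TangentSpace 𝓘(ℝ, E') p))) :
    IsBanachLieSubgroup.{u, v} (MulAction.stabilizer G p) := by
  have : ContinuousSMul G M := ContMDiffSMul.continuousSMul (I := 𝓘(ℝ, E)) (I' := 𝓘(ℝ, E')) ∞
  have : T1Space M := ChartedSpace.t1Space E' M
  refine ⟨?_, ?_⟩
  · have : (MulAction.stabilizer G p : Set G) = (fun g : G => g • p) ⁻¹' {p} := by
      ext g; simp
    rw [this]
    exact isClosed_singleton.preimage (continuous_id.smul continuous_const)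
  obtain ⟨c, hc, h1, hc1⟩ := exists_centered_chart (E := E) (1 : G)
  obtain ⟨b, hb, hp, hbp⟩ := exists_centered_chart (E := E') p
  have h0 : (0 : E) ∈ c.target := hc1 ▸ c.map_source h1
  have hs0 : c.symm 0 = 1 := by rw [← hc1, c.left_inv h1]
  have hs0' : b.symm 0 = p := by rw [← hbp, b.left_inv hp]
  have hsymm := tendsto_symm_of_centered h1 hc1
  -- the orbit map in charts; near `0` its zero set is the stabilizer
  set f : E → E' := fun x => b (c.symm x • p) with hf
  have hf0 : f 0 = 0 := by simp [hf, hs0, hbp]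
  have hfsmooth : ContDiffAt ℝ ∞ f 0 := by
    have := (contDiffAt_action_in_chart hc h1 hc1 hb hp hbp).comp (0 : E)
      (f := fun x => (x, (0 : E'))) (contDiffAt_id.prodMk contDiffAt_const)
    refine this.congr_of_eventuallyEq (.of_forall fun x => ?_)
    simp [hf, hs0']
  have hT := (hfsmooth.differentiableAt (by simp)).hasFDerivAt
  set T := fderiv ℝ f 0
  have hTcl := isClosed_range_fderiv_orbit hc h1 hc1 hb hp hT hclosed
  have hzero : ∀ᶠ x in 𝓝 0, (f x = 0 ↔ c.symm x • p = p) := by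
    have horb : Tendsto (fun x => c.symm x • p) (𝓝 0) (𝓝 p) := by
      simpa using hsymm.smul (tendsto_const_nhds (x := p))
    filter_upwards [horb.eventually (b.open_source.mem_nhds hp)] with x hx
    refine ⟨fun h => b.injOn hx hp (by rw [hbp]; exact h), fun h => by simp [hf, h, hbp]⟩
  -- squaring has derivative `2` and is inverted by a halving map
  obtain ⟨hsq, hsq', hsqc⟩ := squaring_in_chart hc h1 hc1
  obtain ⟨t, ht, hst⟩ := exists_isHalving_of_hasFDerivAt_two hsq (by simp [hs0, hc1]) hsq'
  have htt : Tendsto t (𝓝 0) (𝓝 0) := by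
    simpa only [ContinuousAt, ht.map_zero] using ht.hasFDerivAt.continuousAt
  have hft : ∀ᶠ x in 𝓝 0, ‖f x‖ ≤ 5 / 2 * ‖f (t x)‖ := by
    filter_upwards [htt.eventually (norm_orbit_sq_le hc h1 hc1 hb hp hbp), htt.eventually hsqc, hst]
      with x hx hxc hxt
    rw [hxt] at hxc
    simp only [hf, hxc]
    exact hx
  obtain ⟨hd, hdc⟩ := division_in_chart hc h1 hc1
  have hfd : ∀ᶠ q in 𝓝 (0 : E × E), f q.1 = 0 → f q.2 = 0 →
      f (c (c.symm q.1 * (c.symm q.2)⁻¹)) = 0 := by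
    filter_upwards [hdc, (continuous_fst.tendsto' (0 : E × E) (0 : E) rfl).eventually hzero,
      (continuous_snd.tendsto' (0 : E × E) (0 : E) rfl).eventually hzero] with q hq hq1 hq2 e1 e2
    have e3 : (c.symm q.2)⁻¹ • p = p := inv_smul_eq_iff.2 (hq2.1 e2).symm
    simp only [hf]
    rw [hq, mul_smul, e3, hq1.1 e1, hbp]
  have hker := eventually_eq_zero_of_koenigs_mem_ker ht (hfsmooth.of_le ENat.LEInfty.out) hf0 hT hft
  have hker' := eventually_koenigs_mem_ker_of_eq_zero ht hf0 hT hTcl hd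
    (.of_forall fun x => by simp [hc1]) hfd hker
  -- the linearization provides the slice chart
  obtain ⟨r, C, hr⟩ := ht.exists_halvingOn
  obtain ⟨e, he, he0, hes, het⟩ := exists_openPartialHomeomorph_of_contDiffAt
    (ContinuousLinearEquiv.refl ℝ E) (f := koenigs t) (a := 0)
    (by
      filter_upwards [ball_mem_nhds (0 : E) hr.pos] with x hx
      exact hr.contDiffAt_koenigs ht (by simpa using hx))
    hr.hasFDerivAt_koenigs_zero
  obtain ⟨U, hU, hUo, h0U⟩ := _root_.eventually_nhds_iff.1 (hzero.and (hker.and hker'))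
  let e' := e.restrOpen U hUo
  have hV : IsClosed ((LinearMap.ker (T : E →ₗ[ℝ] E') : Submodule ℝ E) : Set E) := T.isClosed_ker
  have : CompleteSpace (LinearMap.ker (T : E →ₗ[ℝ] E')) := hV.completeSpace_coe
  refine isBanachLieGroup_of_slice (MulAction.stabilizer G p) (LinearMap.ker (T : E →ₗ[ℝ] E'))
    (c ≫ₕ e') (c.trans_mem_maximalAtlas hc (fun x hx => ?_) (fun y hy => ?_)) ?_ ?_
  · have : (e' : E → E) = koenigs t := he
    rw [this]
    exact hes x hx.1
  · exact het y hy.1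
  · rw [OpenPartialHomeomorph.trans_source]
    refine ⟨h1, ?_⟩
    rw [Set.mem_preimage, hc1]
    exact ⟨he0, h0U⟩
  · intro g hg
    rw [OpenPartialHomeomorph.trans_source] at hg
    obtain ⟨hz, hk, hk'⟩ := hU _ hg.2.2
    rw [c.left_inv hg.1] at hz
    rw [MulAction.mem_stabilizer_iff, ← hz]
    change _ ↔ T (e (c g)) = 0
    rw [he]
    exact ⟨hk', hk⟩
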